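/- A \emph{Borel groupoid} is a groupoid $G$ (a small category, identified with its set of arrows, in which every arrow is invertible) endowed with a standard Borel structure for which composition $G^2\to G$ and inversion $G\to G$ are Borel maps and the set of objects $G^0$, identified with the set of identity arrows, is a Borel subset of $G$. Here $G^2=\{(\gamma,\rho): s(\gamma)=r(\rho)\}$, where $s$ and $r$ denote the source and range maps. A Borel groupoid $G$ is \emph{countable} if for every $x\in G^0$ the set $Gx=s^{-1}(x)$ is countable. A \emph{Polish groupoid} is a groupoid $G$ with a topology that has a countable basis of open sets which are Polish in the relative topology, such that composition and inversion are continuous and open, and such that $G^0$ and, for every $x\in G^0$, the sets $Gx=s^{-1}(x)$ and $xG=r^{-1}(x)$ are Polish in the subspace topology. It is \emph{étale} if $s,r\colon G\to G^0$ are local homeomorphisms, \emph{regular} if its topology is regular, and \emph{zero-dimensional} if its topology has a basis of clopen sets. \textbf{Theorem.} Every countable Borel groupoid $G$ admits a topology whose Borel $\sigma$-algebra is the given Borel structure of $G$ and which makes $G$ a regular, zero-dimensional, étale Polish groupoid. In other words, $G$ is Borel isomorphic to a regular zero-dimensional étale Polish groupoid. -/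

import Mathlib

open CategoryTheory TopologicalSpace

universe v u

/-- The set of all arrows of a groupoid. An arrow `γ` has source `γ.left` and
range `γ.right`. -/
abbrev GroupoidArrows (C : Type u) [Groupoid.{v} C] : Type (max u v) :=
  Quiver.Total C

namespace GroupoidArrows

variable (C : Type u) [Groupoid.{v} C]

/-- The identity arrow of an object. -/
def idArrow {C : Type u} [Groupoid.{v} C] (x : C) : GroupoidArrows C :=
  ⟨x, x, 𝟙 x⟩

/-- The set of objects, regarded as a subset of the set of arrows by identifying an object
with its identity arrow. -/
def objects : Set (GroupoidArrows C) :=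
  Set.range (fun x : C => idArrow x)

/-- The source map, with values in the set of objects. -/
def source (γ : GroupoidArrows C) : objects C :=
  ⟨idArrow γ.left, γ.left, rfl⟩

/-- The range map, with values in the set of objects. -/
def target (γ : GroupoidArrows C) : objects C :=
  ⟨idArrow γ.right, γ.right, rfl⟩

/-- The set of pairs `(γ, ρ)` of composable arrows: the source of `γ` is the range of `ρ`. -/
def composable : Set (GroupoidArrows C × GroupoidArrows C) :=
  {p | p.1.left = p.2.right}

/-- Composition of arrows: `(γ, ρ)` is sent to `γρ`, which is `ρ` followed by `γ`. -/
def mul (p : composable C) : GroupoidArrows C :=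
  ⟨p.1.2.left, p.1.1.right, p.1.2.hom ≫ eqToHom (Eq.symm p.2) ≫ p.1.1.hom⟩

/-- Inversion of arrows. -/
def inv (γ : GroupoidArrows C) : GroupoidArrows C :=
  ⟨γ.right, γ.left, Groupoid.inv γ.hom⟩

/-- The arrows with source `x`. -/
def sourceFiber {C : Type u} [Groupoid.{v} C] (x : C) : Set (GroupoidArrows C) :=
  {γ | γ.left = x}

/-- The arrows with range `x`. -/
def targetFiber {C : Type u} [Groupoid.{v} C] (x : C) : Set (GroupoidArrows C) :=
  {γ | γ.right = x}

end GroupoidArrows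

open GroupoidArrows in
/-- A (standard) Borel groupoid: the set of arrows is a standard Borel space, composition and
inversion are Borel maps, and the set of objects is a Borel subset. The set of composable pairs
carries the Borel structure induced from the product. -/
structure IsBorelGroupoid (C : Type u) [Groupoid.{v} C]
    [MeasurableSpace (GroupoidArrows C)] : Prop where
  standardBorel : StandardBorelSpace (GroupoidArrows C)
  measurable_mul : Measurable (mul C)
  measurable_inv : Measurable (inv C)
  measurableSet_objects : MeasurableSet (objects C)

open GroupoidArrows in
/-- A countable Borel groupoid: every object is the source of at most countably many arrows. -/
structure IsCountableBorelGroupoid (C : Type u) [Groupoid.{v} C]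
    [MeasurableSpace (GroupoidArrows C)] : Prop extends IsBorelGroupoid C where
  countable_sourceFiber : ∀ x : C, (sourceFiber x).Countable

/-- A locally Polish space: there is a countable basis of open sets that are Polish spaces in
the relative topology. -/
def IsLocallyPolish (X : Type u) [TopologicalSpace X] : Prop :=
  ∃ B : Set (Set X), B.Countable ∧ IsTopologicalBasis B ∧ ∀ U ∈ B, PolishSpace U

/-- A zero-dimensional space: the clopen sets form a basis. -/
def IsZeroDimensional (X : Type u) [TopologicalSpace X] : Prop :=
  IsTopologicalBasis {U : Set X | IsClopen U}

open GroupoidArrows in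
/-- A Polish groupoid: the topology on the set of arrows is locally Polish, composition and
inversion are continuous and open, and the set of objects and all the source and range fibers
are Polish in the subspace topology. -/
structure IsPolishGroupoid (C : Type u) [Groupoid.{v} C]
    [TopologicalSpace (GroupoidArrows C)] : Prop where
  locallyPolish : IsLocallyPolish (GroupoidArrows C)
  continuous_mul : Continuous (mul C)
  isOpenMap_mul : IsOpenMap (mul C)
  continuous_inv : Continuous (inv C)
  isOpenMap_inv : IsOpenMap (inv C)
  polish_objects : PolishSpace (objects C)
  polish_sourceFiber : ∀ x : C, PolishSpace (sourceFiber x)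
  polish_targetFiber : ∀ x : C, PolishSpace (targetFiber x)

open GroupoidArrows in
/-- An étale Polish groupoid: a Polish groupoid whose source and range maps are local
homeomorphisms onto the space of objects. -/
structure IsEtalePolishGroupoid (C : Type u) [Groupoid.{v} C]
    [TopologicalSpace (GroupoidArrows C)] : Prop extends IsPolishGroupoid C where
  isLocalHomeomorph_source : IsLocalHomeomorph (source C)
  isLocalHomeomorph_target : IsLocalHomeomorph (target C)

/-! The groupoid is a countable union of Borel bisections, that is, Borel sets on which source and
range are injective: by Lusin–Novikov the countable-to-one source map gives countably many Borel
sets on which it is injective, and one intersects these with inverses of such sets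
(`exists_bisection_cover`). The product of a Borel set with a Borel bisection is again Borel, being
an injective Borel image. Hence there is a compatible Polish topology with a countable clopen basis
that contains the object set and the bisections and is closed under inverses and under such products
(`StandardBorelSpace.exists_polishSpace_clopen_basis_closed`). Small basic bisections then make
multiplication continuous and open, and the source a local homeomorphism. Lusin–Novikov is proved by
contraposition: if no countable cover by injectivity sets exists, splitting fiber-large families
repeatedly builds a Cantor set inside one fiber. -/

/-! ### The Lusin–Novikov theorem -/

namespace LusinNovikov

open Set MeasureTheory

/-- A countable family of Borel sets on each of which `f` is injective. -/
def InjFamily {X Y : Type*} [MeasurableSpace X] (f : X → Y) (S : Set (Set X)) : Prop :=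
  S.Countable ∧ ∀ c ∈ S, MeasurableSet c ∧ InjOn f c

/-- A family `U` indexed by `K` is fiber-large for `f` if no countable union of Borel sets on which
`f` is injective can be removed so that the remaining sets have no common value of `f`. -/
def FiberLarge {X Y κ : Type*} [MeasurableSpace X] (f : X → Y) (K : Set κ) (U : κ → Set X) : Prop :=
  ∀ S, InjFamily f S → ∃ y, ∀ k ∈ K, y ∈ f '' (U k \ ⋃₀ S)

variable {X Y : Type*} [MetricSpace X] [CompleteSpace X] [SecondCountableTopology X]
  [MeasurableSpace X] [BorelSpace X] [TopologicalSpace Y] [T2Space Y] [MeasurableSpace Y]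
  [BorelSpace Y] {f : X → Y}

/-- An analytic set on which `f` is injective is contained in such a Borel set. -/
theorem exists_measurableSet_injOn_superset (hf : Continuous f) {A : Set X}
    (hA : AnalyticSet A) (hinj : InjOn f A) : ∃ B, MeasurableSet B ∧ InjOn f B ∧ A ⊆ B := by
  obtain ⟨b, hbc, -, hb⟩ := exists_countable_basis X
  -- By injectivity, disjoint `u`, `v` cut `A` into pieces with disjoint analytic images, so Lusin
  -- separation applies.
  have key : ∀ u v : b, ∃ C : Set Y, MeasurableSet C ∧
      (Disjoint u.1 v.1 → f '' (A ∩ u) ⊆ C ∧ Disjoint (f '' (A ∩ v)) C) := by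
    intro u v
    by_cases huv : Disjoint u.1 v.1
    · have h1 : ∀ w : b, AnalyticSet (f '' (A ∩ w)) := fun w => by
        refine AnalyticSet.image_of_continuous ?_ hf
        have : AnalyticSet (⋂ i : Bool, cond i A w.1) :=
          AnalyticSet.iInter (by
            rintro (_ | _)
            · exact (hb.isOpen w.2).measurableSet.analyticSet
            · exact hA)
        rwa [← inter_eq_iInter] at this
      obtain ⟨C, hC1, hC2, hC3⟩ := (h1 u).measurablySeparable (h1 v) (by
        rw [disjoint_left]
        rintro _ ⟨x, hx, rfl⟩ ⟨x', hx', h⟩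
        have := hinj hx'.1 hx.1 h
        subst this
        exact disjoint_left.1 huv hx.2 hx'.2)
      exact ⟨C, hC3, fun _ => ⟨hC1, hC2⟩⟩
    · exact ⟨∅, .empty, fun h => absurd h huv⟩
  choose C hC hsep using key
  have : Countable b := hbc.to_subtype
  -- Points of this set in `u` have value in `C u v` and those in `v` have value outside it, so two
  -- points separated by basic sets have different values.
  refine ⟨⋂ (u : b) (v : b) (_ : Disjoint u.1 v.1),
    ((u.1)ᶜ ∪ f ⁻¹' C u v) ∩ ((v.1)ᶜ ∪ (f ⁻¹' C u v)ᶜ), ?_, ?_, ?_⟩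
  · refine .iInter fun u => .iInter fun v => .iInter fun _ => ?_
    have hm := hf.measurable (hC u v)
    exact ((hb.isOpen u.2).measurableSet.compl.union hm).inter
      ((hb.isOpen v.2).measurableSet.compl.union hm.compl)
  · intro x hx x' hx' hxx
    by_contra hne
    obtain ⟨O, O', hO, hO', hxO, hxO', hd⟩ := t2_separation hne
    obtain ⟨u, hu, hxu, huO⟩ := hb.exists_subset_of_mem_open hxO hO
    obtain ⟨v, hv, hxv, hvO⟩ := hb.exists_subset_of_mem_open hxO' hO'
    simp only [mem_iInter] at hx hx'
    have h := hx ⟨u, hu⟩ ⟨v, hv⟩ (hd.mono huO hvO)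
    have h' := hx' ⟨u, hu⟩ ⟨v, hv⟩ (hd.mono huO hvO)
    have h1 := h.1.resolve_left (fun h => h hxu)
    have h2 := h'.2.resolve_left (fun h => h hxv)
    apply h2
    simpa [hxx] using h1
  · intro x hx
    simp only [mem_iInter]
    intro u v huv
    obtain ⟨h1, h2⟩ := hsep u v huv
    constructor
    · by_cases hxu : x ∈ u.1
      · exact .inr (h1 ⟨x, ⟨hx, hxu⟩, rfl⟩)
      · exact .inl hxu
    · by_cases hxv : x ∈ v.1
      · exact .inr (disjoint_left.1 h2 ⟨x, ⟨hx, hxv⟩, rfl⟩)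
      · exact .inl hxv

/-- Two distinct points have basic neighbourhoods of small diameter with disjoint closures. -/
theorem exists_basis_separation {X : Type*} [MetricSpace X] {b : Set (Set X)} (hb : IsTopologicalBasis b) {x x' : X}
    (hne : x ≠ x') {ε : ENNReal} (hε : 0 < ε) :
    ∃ u ∈ b, ∃ v ∈ b, x ∈ u ∧ x' ∈ v ∧ Disjoint (closure u) (closure v) ∧
      Metric.ediam u ≤ ε ∧ Metric.ediam v ≤ ε := by
  obtain ⟨O, hO, O', hO', hd⟩ := Filter.disjoint_iff.1 (disjoint_nhds_nhds.2 hne)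
  have small : ∀ z : X, ∀ O ∈ nhds z, ∃ u ∈ b, z ∈ u ∧ closure u ⊆ O ∧ Metric.ediam u ≤ ε := by
    intro z O hO
    obtain ⟨T, hT, hTc, hTO⟩ := exists_mem_nhds_isClosed_subset hO
    have hball : Metric.eball z (ε / 2) ∈ nhds z :=
      Metric.eball_mem_nhds z (ENNReal.half_pos hε.ne')
    obtain ⟨u, hu, hzu, huT⟩ := hb.mem_nhds_iff.1 (Filter.inter_mem hT hball)
    refine ⟨u, hu, hzu, (closure_minimal (huT.trans inter_subset_left) hTc).trans hTO, ?_⟩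
    refine (Metric.ediam_mono (huT.trans inter_subset_right)).trans ?_
    refine Metric.ediam_eball_le.trans ?_
    rw [ENNReal.mul_div_cancel (by simp) (by simp)]
  obtain ⟨u, hu, hxu, huO, hud⟩ := small x O hO
  obtain ⟨v, hv, hxv, hvO, hvd⟩ := small x' O' hO'
  exact ⟨u, hu, v, hv, hxu, hxv, hd.mono huO hvO, hud, hvd⟩

/-- If every small separated pair of basic sets failed, the countably many witnesses of failure
would together form one removable family `T`. What is left of `U p` over the common values would
then be an analytic injectivity set; a Borel enlargement of it could be removed too, contradicting
largeness. -/
theorem FiberLarge.split {κ : Type*} [DecidableEq κ] (hf : Continuous f) {K : Set κ}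
    (hK : K.Finite) {U : κ → Set X} (hU : ∀ k, MeasurableSet (U k)) (hl : FiberLarge f K U)
    {p q : κ} (hp : p ∈ K) (hpq : p ≠ q) (hUpq : U p = U q) {ε : ENNReal} (hε : 0 < ε) :
    ∃ V W : Set X, MeasurableSet V ∧ MeasurableSet W ∧ V ⊆ U p ∧ W ⊆ U p ∧
      Metric.ediam V ≤ ε ∧ Metric.ediam W ≤ ε ∧ Disjoint (closure V) (closure W) ∧
      FiberLarge f K (Function.update (Function.update U p V) q W) := by
  obtain ⟨b, hbc, -, hb⟩ := exists_countable_basis X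
  have : Countable b := hbc.to_subtype
  have : Finite K := hK
  have : Nonempty K := ⟨⟨p, hp⟩⟩
  by_contra! hcon
  have bad : ∀ w : b × b, ∃ S, InjFamily f S ∧ (Disjoint (closure w.1.1) (closure w.2.1) →
      Metric.ediam w.1.1 ≤ ε → Metric.ediam w.2.1 ≤ ε → ∀ y, ∃ k ∈ K,
        y ∉ f '' (Function.update (Function.update U p (U p ∩ w.1)) q (U p ∩ w.2) k \ ⋃₀ S)) := by
    intro w
    by_cases hw : Disjoint (closure w.1.1) (closure w.2.1) ∧
      Metric.ediam w.1.1 ≤ ε ∧ Metric.ediam w.2.1 ≤ ε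
    · obtain ⟨hd, h1, h2⟩ := hw
      have := hcon (U p ∩ w.1) (U p ∩ w.2) ((hU p).inter (hb.isOpen w.1.2).measurableSet)
        ((hU p).inter (hb.isOpen w.2.2).measurableSet) inter_subset_left inter_subset_left
        ((Metric.ediam_mono inter_subset_right).trans h1)
        ((Metric.ediam_mono inter_subset_right).trans h2)
        (hd.mono (closure_mono inter_subset_right) (closure_mono inter_subset_right))
      simp only [FiberLarge, not_forall, not_exists] at this
      obtain ⟨S, hS, h⟩ := this
      refine ⟨S, hS, fun _ _ _ y => ?_⟩
      obtain ⟨k, hk, hky⟩ := h y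
      exact ⟨k, hk, hky⟩
    · exact ⟨∅, ⟨countable_empty, by simp⟩, fun h h1 h2 => absurd ⟨h, h1, h2⟩ hw⟩
  choose S hS hbad using bad
  set T := ⋃ w, S w with hT
  have hTinj : InjFamily f T := ⟨countable_iUnion fun w => (hS w).1, fun c hc => by
    obtain ⟨w, hw⟩ := mem_iUnion.1 hc
    exact (hS w).2 c hw⟩
  have hTm : MeasurableSet (⋃₀ T) := .sUnion hTinj.1 fun c hc => (hTinj.2 c hc).1
  let D := ⋂ k : K, f '' (U k \ ⋃₀ T)
  have hD : AnalyticSet D := AnalyticSet.iInter fun k =>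
    ((hU k).diff hTm).analyticSet.image_of_continuous hf
  have hA : AnalyticSet ((U p \ ⋃₀ T) ∩ f ⁻¹' D) := by
    have : AnalyticSet (⋂ i : Bool, cond i (U p \ ⋃₀ T) (f ⁻¹' D)) :=
      AnalyticSet.iInter (by
        rintro (_ | _)
        · exact hD.preimage hf
        · exact ((hU p).diff hTm).analyticSet)
    rwa [← inter_eq_iInter] at this
  -- Two points with the same value would lie in a small separated pair `u`, `v`. They realize this
  -- value at `p` and `q`, and membership in `D` realizes it at all other indices, against `hbad`.
  have hAinj : InjOn f ((U p \ ⋃₀ T) ∩ f ⁻¹' D) := by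
    rintro x ⟨hx, hxD⟩ x' ⟨hx', -⟩ hxx
    by_contra hne
    obtain ⟨u, hu, v, hv, hxu, hxv, hd, h1, h2⟩ := exists_basis_separation hb hne hε
    obtain ⟨k, hk, hky⟩ := hbad (⟨u, hu⟩, ⟨v, hv⟩) hd h1 h2 (f x)
    apply hky
    have hsub : ⋃₀ S (⟨u, hu⟩, ⟨v, hv⟩) ⊆ ⋃₀ T := sUnion_subset_sUnion (subset_iUnion S _)
    by_cases hkq : k = q
    · subst hkq
      rw [Function.update_self]
      exact ⟨x', ⟨⟨hx'.1, hxv⟩, fun h => hx'.2 (hsub h)⟩, hxx.symm⟩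
    · rw [Function.update_of_ne hkq]
      by_cases hkp : k = p
      · subst hkp
        rw [Function.update_self]
        exact ⟨x, ⟨⟨hx.1, hxu⟩, fun h => hx.2 (hsub h)⟩, rfl⟩
      · rw [Function.update_of_ne hkp]
        exact image_mono (sdiff_subset_sdiff_right hsub) (mem_iInter.1 hxD ⟨k, hk⟩)
  obtain ⟨B, hBm, hBinj, hAB⟩ := exists_measurableSet_injOn_superset hf hA hAinj
  obtain ⟨y, hy⟩ := hl (insert B T) ⟨hTinj.1.insert B, by
    rintro c (rfl | hc)
    · exact ⟨hBm, hBinj⟩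
    · exact hTinj.2 c hc⟩
  rw [sUnion_insert] at hy
  obtain ⟨x, ⟨hxU, hxB⟩, rfl⟩ := hy p hp
  refine hxB (.inl (hAB ⟨⟨hxU, fun h => hxB (.inr h)⟩, mem_iInter.2 fun k => ?_⟩))
  exact image_mono (sdiff_subset_sdiff_right subset_union_right) (hy k k.2)

theorem FiberLarge.split_level (hf : Continuous f) {U : List Bool → Set X}
    (hU : ∀ k, MeasurableSet (U k)) {n : ℕ} (hl : FiberLarge f {l | l.length = n} U)
    {ε : ENNReal} (hε : 0 < ε) :
    ∃ U' : List Bool → Set X, (∀ k, MeasurableSet (U' k)) ∧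
      FiberLarge f {l | l.length = n + 1} U' ∧ ∀ l, l.length = n →
        (∀ b, U' (b :: l) ⊆ U l ∧ Metric.ediam (U' (b :: l)) ≤ ε) ∧
        Disjoint (closure (U' (true :: l))) (closure (U' (false :: l))) := by
  have key : ∀ s : Finset (List Bool), (∀ l ∈ s, l.length = n) →
      ∃ U' : List Bool → Set X, (∀ k, MeasurableSet (U' k)) ∧
      FiberLarge f {l | l.length = n + 1} U' ∧ (∀ l ∉ s, ∀ b, U' (b :: l) = U l) ∧
      ∀ l ∈ s, (∀ b, U' (b :: l) ⊆ U l ∧ Metric.ediam (U' (b :: l)) ≤ ε) ∧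
        Disjoint (closure (U' (true :: l))) (closure (U' (false :: l))) := by
    intro s
    induction s using Finset.induction_on with
    | empty =>
      intro _
      -- Both children start as copies of the parent; each induction step then separates one pair of
      -- equal siblings.
      refine ⟨fun l => U l.tail, fun k => hU _, fun S hS => ?_, by simp, by simp⟩
      obtain ⟨y, hy⟩ := hl S hS
      refine ⟨y, fun k hk => hy k.tail ?_⟩
      have hk' : k.length = n + 1 := hk
      simp [hk']
    | insert l s hls ih =>
      intro hs
      obtain ⟨U', hm, hlarge, heq, hsp⟩ := ih fun l hl => hs l (Finset.mem_insert_of_mem hl)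
      have hln := hs l (Finset.mem_insert_self _ _)
      obtain ⟨V, W, hV, hW, hVU, hWU, hVd, hWd, hd, hlarge'⟩ := hlarge.split hf
        (List.finite_length_eq Bool (n + 1)) hm (p := true :: l) (q := false :: l)
        (by simp [hln]) (by simp) (by rw [heq l hls, heq l hls]) hε
      rw [heq l hls] at hVU hWU
      refine ⟨_, ?_, hlarge', ?_, ?_⟩
      · intro k
        by_cases hkq : k = false :: l
        · subst hkq; simpa using hW
        · rw [Function.update_of_ne hkq]
          by_cases hkp : k = true :: l
          · subst hkp; simpa using hV
          · rw [Function.update_of_ne hkp]; exact hm k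
      · intro l' hl' b
        rw [Finset.mem_insert, not_or] at hl'
        rw [Function.update_of_ne (by simp [hl'.1]), Function.update_of_ne (by simp [hl'.1])]
        exact heq l' hl'.2 b
      · intro l' hl'
        by_cases hll : l' = l
        · subst hll
          refine ⟨?_, by simpa using hd⟩
          rintro (_ | _)
          · simpa using ⟨hWU, hWd⟩
          · simpa using ⟨hVU, hVd⟩
        · have h := hsp l' ((Finset.mem_insert.1 hl').resolve_left hll)
          have e : ∀ b, Function.update (Function.update U' (true :: l) V) (false :: l) W (b :: l')
              = U' (b :: l') := fun b => by
            rw [Function.update_of_ne (by simp [hll]), Function.update_of_ne (by simp [hll])]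
          simpa only [e] using h
  obtain ⟨U', h1, h2, -, h3⟩ := key (List.finite_length_eq Bool n).toFinset (by simp)
  exact ⟨U', h1, h2, fun l hl => h3 l (by simpa using hl)⟩

/-- If the space is not a countable union of Borel sets on which `f` is injective, then some fiber
of `f` is uncountable. -/
theorem exists_not_countable_fiber (hf : Continuous f)
    (h0 : ¬ ∃ S, InjFamily f S ∧ ⋃₀ S = univ) : ∃ y, ¬ (f ⁻¹' {y}).Countable := by
  have start : FiberLarge f {l : List Bool | l.length = 0} fun _ => (univ : Set X) := by
    intro S hS
    have : ⋃₀ S ≠ univ := fun h => h0 ⟨S, hS, h⟩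
    obtain ⟨x, hx⟩ := (ne_univ_iff_exists_notMem _).1 this
    exact ⟨f x, fun k _ => ⟨x, ⟨mem_univ x, hx⟩, rfl⟩⟩
  let St (n : ℕ) := {U : List Bool → Set X //
    (∀ k, MeasurableSet (U k)) ∧ FiberLarge f {l | l.length = n} U}
  have step : ∀ (n : ℕ) (U : St n), ∃ U' : St (n + 1), ∀ l : List Bool, l.length = n →
        (∀ b, U'.1 (b :: l) ⊆ U.1 l ∧ Metric.ediam (U'.1 (b :: l)) ≤ ((n : ENNReal))⁻¹) ∧
        Disjoint (closure (U'.1 (true :: l))) (closure (U'.1 (false :: l))) := by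
    rintro n ⟨U, hm, hU⟩
    -- For `n = 0` the bound is `⊤`, hence no condition.
    obtain ⟨U', h1, h2, h3⟩ := hU.split_level hf hm (ε := (n : ENNReal)⁻¹) (by simp)
    exact ⟨⟨U', h1, h2⟩, h3⟩
  choose g hg using step
  let u : ∀ n, St n := fun n => Nat.rec ⟨fun _ => univ, fun _ => .univ, start⟩ g n
  let A : List Bool → Set X := fun l => (u l.length).1 l
  have hAg : ∀ l : List Bool, (∀ b, A (b :: l) ⊆ A l ∧
      Metric.ediam (A (b :: l)) ≤ (l.length : ENNReal)⁻¹) ∧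
      Disjoint (closure (A (true :: l))) (closure (A (false :: l))) :=
    fun l => hg l.length (u l.length) l rfl
  have hcommon : ∀ n, ∃ y, ∀ l : List Bool, l.length = n → y ∈ f '' A l := by
    intro n
    obtain ⟨y, hy⟩ := (u n).2.2 ∅ ⟨countable_empty, by simp⟩
    refine ⟨y, fun l hl => ?_⟩
    subst hl
    simpa using hy l rfl
  -- The `A l` are only Borel, so completeness yields branch points in the closures. A branch point
  -- need not lie in the sets `A l`, so its value is controlled through continuity of `f`.
  let A' : List Bool → Set X := fun l => closure (A l)
  have hdiam : CantorScheme.VanishingDiam A' := by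
    intro x
    rw [← Filter.tendsto_add_atTop_iff_nat 1]
    refine tendsto_of_tendsto_of_tendsto_of_le_of_le tendsto_const_nhds
      ENNReal.tendsto_inv_nat_nhds_zero (fun _ => zero_le) fun n => ?_
    have := ((hAg (PiNat.res x n)).1 (x n)).2
    rw [PiNat.res_length] at this
    simpa only [A', Metric.ediam_closure, PiNat.res_succ] using this
  have hanti : CantorScheme.ClosureAntitone A' := CantorScheme.Antitone.closureAntitone
    (fun l b => closure_mono ((hAg l).1 b).1) fun _ => isClosed_closure
  have hne : ∀ l, (A' l).Nonempty := fun l => by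
    obtain ⟨y, hy⟩ := hcommon l.length
    obtain ⟨x, hx, -⟩ := hy l rfl
    exact ⟨x, subset_closure hx⟩
  have hdisj : CantorScheme.Disjoint A' := by
    rintro l (_ | _) (_ | _) hab
    · exact absurd rfl hab
    · exact (hAg l).2.symm
    · exact (hAg l).2
    · exact absurd rfl hab
  have hdom := hanti.map_of_vanishingDiam hdiam hne
  let F : (ℕ → Bool) → X := fun x => (CantorScheme.inducedMap A').2 ⟨x, hdom ▸ mem_univ x⟩
  have hFinj : Function.Injective F := fun x x' h => by
    simpa using hdisj.map_injective h
  have hFmem : ∀ x n, F x ∈ A' (PiNat.res x n) := fun x n => CantorScheme.map_mem _ n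
  have hsub : ∀ x, ∀ O : Set Y, IsOpen O → f (F x) ∈ O → ∃ N, ∀ n ≥ N,
      A (PiNat.res x n) ⊆ f ⁻¹' O := by
    intro x O hO hx
    obtain ⟨ε, hε, hball⟩ := EMetric.isOpen_iff.1 (hO.preimage hf) (F x) hx
    obtain ⟨N, hN⟩ := Filter.eventually_atTop.1 ((hdiam x).eventually (gt_mem_nhds hε))
    refine ⟨N, fun n hn z hz => hball ?_⟩
    exact (Metric.edist_le_ediam_of_mem (subset_closure hz) (hFmem x n)).trans_lt (hN n hn)
  -- All sets of one level share a value of `f`, whereas separated values at two branch points would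
  -- force disjoint images deep enough along the branches.
  have hconst : ∀ x x', f (F x) = f (F x') := by
    intro x x'
    by_contra hne
    obtain ⟨O, O', hO, hO', hxO, hxO', hd⟩ := t2_separation hne
    obtain ⟨N, hN⟩ := hsub x O hO hxO
    obtain ⟨N', hN'⟩ := hsub x' O' hO' hxO'
    obtain ⟨y, hy⟩ := hcommon (max N N')
    obtain ⟨z, hz, hzy⟩ := hy _ (PiNat.res_length x _)
    obtain ⟨z', hz', hzy'⟩ := hy _ (PiNat.res_length x' _)
    have h1 : f z ∈ O := hN _ (le_max_left _ _) hz
    have h2 : f z' ∈ O' := hN' _ (le_max_right _ _) hz'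
    exact disjoint_left.1 hd (hzy ▸ h1) (hzy' ▸ h2)
  refine ⟨f (F fun _ => true), fun hc => ?_⟩
  have : Countable (f ⁻¹' {f (F fun _ => true)}) := hc.to_subtype
  have : Countable (ℕ → Bool) := Function.Injective.countable
    (f := fun x => (⟨F x, hconst x _⟩ : f ⁻¹' {f (F fun _ => true)}))
    fun x x' h => hFinj (congrArg Subtype.val h)
  obtain ⟨e, he⟩ := exists_surjective_nat (ℕ → Bool)
  obtain ⟨n, hn⟩ := he fun n => !(e n n)
  simpa using congrFun hn n

end LusinNovikov

open Set LusinNovikov in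
/-- **Lusin–Novikov**: a countable-to-one Borel map between standard Borel spaces is injective on
each of countably many Borel sets that cover its domain. -/
theorem Measurable.exists_injOn_cover_of_countable_fibers {X Y : Type*} [MeasurableSpace X]
    [StandardBorelSpace X] [MeasurableSpace Y] [StandardBorelSpace Y] {f : X → Y}
    (hf : Measurable f) (hc : ∀ y, (f ⁻¹' {y}).Countable) :
    ∃ S : Set (Set X), S.Countable ∧ (∀ c ∈ S, MeasurableSet c ∧ InjOn f c) ∧ ⋃₀ S = univ := by
  let := upgradeStandardBorel X
  let := upgradeStandardBorel Y
  -- A finer Polish topology makes `f` continuous without changing the Borel sets.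
  obtain ⟨t, hle, hcont, hpol⟩ := hf.exists_continuous
  have hB : @BorelSpace X t _ :=
    ⟨(eq_borel_upgradeStandardBorel X).trans
      (MeasureTheory.borel_eq_borel_of_le hpol (upgradeStandardBorel X).toPolishSpace hle).symm⟩
  by_contra h
  obtain ⟨y, hy⟩ : ∃ y, ¬ (f ⁻¹' {y}).Countable := by
    clear hle
    let : TopologicalSpace X := t
    let := TopologicalSpace.upgradeIsCompletelyMetrizable X
    refine exists_not_countable_fiber hcont fun ⟨S, hS, hU⟩ => h ⟨S, hS.1, hS.2, hU⟩
  exact hy (hc y)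

/-! ### Polish topologies with clopen bases closed under countably many operations -/

open Set in
/-- Every countable set is contained in a countable set closed under a given binary operation
with countable sets as values. -/
theorem Set.Countable.exists_countable_closed {β : Type*} {I : Set β} (hI : I.Countable)
    (Ψ : β → β → Set β) (hΨ : ∀ a b, (Ψ a b).Countable) :
    ∃ A : Set β, I ⊆ A ∧ A.Countable ∧ ∀ a ∈ A, ∀ b ∈ A, Ψ a b ⊆ A := by
  let next : Set β → Set β := fun S => S ∪ ⋃ a ∈ S, ⋃ b ∈ S, Ψ a b
  let T : ℕ → Set β := fun n => next^[n] I
  have hT : ∀ n, T (n + 1) = next (T n) := fun n => Function.iterate_succ_apply' _ _ _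
  have hmono : Monotone T := monotone_nat_of_le_succ fun n => by
    rw [hT]
    exact subset_union_left
  refine ⟨⋃ n, T n, subset_iUnion T 0, countable_iUnion fun n => ?_, fun a ha b hb => ?_⟩
  · induction n with
    | zero => exact hI
    | succ n ih =>
      rw [hT]
      exact ih.union (ih.biUnion fun a _ => ih.biUnion fun b _ => hΨ a b)
  · obtain ⟨n, hn⟩ := mem_iUnion.1 ha
    obtain ⟨m, hm⟩ := mem_iUnion.1 hb
    refine subset_trans ?_ (subset_iUnion T (max n m + 1))
    rw [hT]
    refine subset_trans ?_ subset_union_right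
    exact subset_biUnion_of_mem (u := fun a => ⋃ b ∈ T (max n m), Ψ a b)
      (hmono (le_max_left n m) hn) |>.trans' (subset_biUnion_of_mem (u := fun b => Ψ a b)
      (hmono (le_max_right n m) hm))

open Set MeasureTheory Topology in
/-- Given countably many Borel sets and countably many binary operations on sets, there is a
compatible Polish topology with a clopen basis that contains the given sets and is closed under
the operations, as far as their values are Borel. -/
theorem StandardBorelSpace.exists_polishSpace_clopen_basis_closed {α ι : Type*} [MeasurableSpace α]
    [StandardBorelSpace α] [Countable ι] {I : Set (Set α)} (hI : I.Countable)
    (hIm : ∀ s ∈ I, MeasurableSet s) (op : ι → Set α → Set α → Set α) :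
    ∃ (_ : TopologicalSpace α) (A : Set (Set α)), PolishSpace α ∧ BorelSpace α ∧
      A.Countable ∧ I ⊆ A ∧ (∀ s ∈ A, IsClopen s) ∧ IsTopologicalBasis A ∧
      ∀ i, ∀ a ∈ A, ∀ b ∈ A, MeasurableSet (op i a b) → op i a b ∈ A := by
  let t₀ : TopologicalSpace α := (upgradeStandardBorel α).toTopologicalSpace
  have hB₀ : BorelSpace α := (upgradeStandardBorel α).toBorelSpace
  have hP₀ : PolishSpace α := (upgradeStandardBorel α).toPolishSpace
  let β := {s : Set α // MeasurableSet s}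
  have hclop : ∀ s : β, ∃ t' : TopologicalSpace α, t' ≤ t₀ ∧ @PolishSpace α t' ∧
      IsClosed[t'] s.1 ∧ IsOpen[t'] s.1 := fun s => s.2.isClopenable
  choose τ hτle hτpol hτc hτo using hclop
  have hbasis : ∀ s : β, ∃ b : Set (Set α), b.Countable ∧ τ s = generateFrom b := fun s =>
    (hτpol s).toSecondCountableTopology.is_open_generated_countable
  choose F hFc hF using hbasis
  obtain ⟨b₀, hb₀c, hb₀⟩ : ∃ b : Set (Set α), b.Countable ∧ t₀ = generateFrom b :=
    SecondCountableTopology.is_open_generated_countable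
  -- `F a` generates a Polish topology in which `a` is clopen. Closing under `F` makes the final
  -- family generate all these topologies at once; the preimage under `Subtype.val` discards
  -- non-Borel values of the operations.
  let Ψ : β → β → Set β := fun a b =>
    Subtype.val ⁻¹' (insert univ (insert (a.1 ∩ b.1) (F a)) ∪ range fun i => op i a b)
  obtain ⟨A, hIA, hAc, hA⟩ := Set.Countable.exists_countable_closed (β := β)
    (I := Subtype.val ⁻¹' (insert univ (I ∪ b₀)))
    (((hI.union hb₀c).insert _).preimage Subtype.val_injective) Ψ
    (fun a b => ((((hFc a).insert _).insert _).union (countable_range _)).preimage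
      Subtype.val_injective)
  let t : TopologicalSpace α := ⨅ i : Option A, i.elim t₀ fun s => τ s
  have htle : t ≤ t₀ := iInf_le (fun i : Option A => i.elim t₀ fun s => τ s) none
  have htτ : ∀ s ∈ A, t ≤ τ s := fun s hs =>
    iInf_le (fun i : Option A => i.elim t₀ fun s => τ s) (some ⟨s, hs⟩)
  have : Countable A := hAc.to_subtype
  have hpol : @PolishSpace α t :=
    .iInf ⟨none, Option.forall.2 ⟨le_rfl, fun s => hτle s⟩⟩
      (Option.forall.2 ⟨hP₀, fun s => hτpol s⟩)
  have hτm : ∀ s : β, ∀ u ∈ F s, MeasurableSet u := fun s u hu => by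
    have h1 : IsOpen[τ s] u := by
      rw [hF s]
      exact isOpen_generateFrom_of_mem hu
    have h2 : MeasurableSet[@borel α (τ s)] u := MeasurableSpace.measurableSet_generateFrom h1
    rw [borel_eq_borel_of_le (hτpol s) hP₀ (hτle s)] at h2
    rwa [hB₀.measurable_eq]
  have hopen : ∀ s ∈ A, IsOpen[t] s.1 := fun s hs => htτ s hs _ (hτo s)
  have hgen : t = generateFrom (Subtype.val '' A) := by
    refine le_antisymm (le_generateFrom ?_) (le_iInf (Option.forall.2 ⟨?_, ?_⟩))
    · rintro _ ⟨s, hs, rfl⟩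
      exact hopen s hs
    · refine le_of_le_of_eq (generateFrom_anti fun u hu => ?_) hb₀.symm
      have hum : MeasurableSet u := by
        have h1 : IsOpen[t₀] u := by
          rw [hb₀]
          exact isOpen_generateFrom_of_mem hu
        exact @IsOpen.measurableSet α u t₀ _ _ h1
      exact ⟨⟨u, hum⟩, hIA (.inr (.inr hu)), rfl⟩
    · intro s
      refine le_of_le_of_eq (generateFrom_anti fun u hu => ?_) (hF s).symm
      exact ⟨⟨u, hτm _ u hu⟩, hA s s.2 s s.2 (.inl (.inr (.inr hu))), rfl⟩
  refine ⟨t, Subtype.val '' A, hpol, ⟨?_⟩, hAc.image _, fun s hs => ?_, ?_, ?_, ?_⟩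
  · rw [borel_eq_borel_of_le hpol hP₀ htle, hB₀.measurable_eq]
  · exact ⟨⟨s, hIm s hs⟩, hIA (.inr (.inl hs)), rfl⟩
  · rintro _ ⟨s, hs, rfl⟩
    exact ⟨⟨htτ s hs _ (hτc s).isOpen_compl⟩, hopen s hs⟩
  · refine ⟨?_, ?_, hgen⟩
    · rintro _ ⟨a, ha, rfl⟩ _ ⟨b, hb, rfl⟩ x hx
      exact ⟨_, ⟨⟨a.1 ∩ b.1, a.2.inter b.2⟩, hA a ha b hb (.inl (.inr (.inl rfl))), rfl⟩, hx,
        Subset.rfl⟩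
    · exact eq_univ_of_forall fun x => ⟨univ, ⟨⟨univ, .univ⟩, hIA (.inl rfl), rfl⟩, mem_univ x⟩
  · rintro i _ ⟨a, ha, rfl⟩ _ ⟨b, hb, rfl⟩ hm
    exact ⟨⟨_, hm⟩, hA a ha b hb (.inr ⟨i, rfl⟩), rfl⟩

/-! ### Products of sets of arrows and bisections -/

namespace GroupoidArrows

open Set

variable {C : Type u} [Groupoid.{v} C]

theorem inv_inv_arrow (γ : GroupoidArrows C) : inv C (inv C γ) = γ := by
  obtain ⟨a, b, f⟩ := γ
  simp [inv]

theorem idArrow_injective : Function.Injective (idArrow : C → GroupoidArrows C) :=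
  fun _ _ h => congrArg Quiver.Total.left h

theorem mul_inv_self_left (γ : GroupoidArrows C) :
    mul C ⟨(inv C γ, γ), rfl⟩ = idArrow γ.left := by
  obtain ⟨a, b, f⟩ := γ
  change (⟨a, a, f ≫ 𝟙 b ≫ Groupoid.inv f⟩ : GroupoidArrows C) = ⟨a, a, 𝟙 a⟩
  simp

theorem mul_mul_inv (p : composable C) (h : (mul C p).left = (inv C p.1.2).right) :
    mul C ⟨(mul C p, inv C p.1.2), h⟩ = p.1.1 := by
  obtain ⟨⟨⟨a, b, f⟩, ⟨c, d, g⟩⟩, had⟩ := p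
  change a = d at had
  subst had
  change (⟨a, b, Groupoid.inv g ≫ 𝟙 c ≫ g ≫ 𝟙 a ≫ f⟩ : GroupoidArrows C) = ⟨a, b, f⟩
  simp

theorem mul_inv_mul (γ ρ : GroupoidArrows C) (h : γ.left = (inv C ρ).right)
    (h' : (mul C ⟨(γ, inv C ρ), h⟩).left = ρ.right) :
    mul C ⟨(mul C ⟨(γ, inv C ρ), h⟩, ρ), h'⟩ = γ := by
  have := mul_mul_inv ⟨(γ, inv C ρ), h⟩ (by simpa [inv_inv_arrow] using h')
  simpa only [inv_inv_arrow] using this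

/-- The set of products of composable arrows in two sets of arrows. -/
def prodSet (A B : Set (GroupoidArrows C)) : Set (GroupoidArrows C) :=
  mul C '' {p | p.1.1 ∈ A ∧ p.1.2 ∈ B}

/-- If `γ = w v⁻¹` and `γρ` is defined with `v`, `ρ` in `V`, then `v` and `ρ` have the same range,
so `v = ρ` and `γρ = w`. -/
theorem mul_mem_of_mem_prodSet_inv {W V : Set (GroupoidArrows C)}
    (hV : InjOn Quiver.Total.right V) {p : composable C}
    (h1 : p.1.1 ∈ prodSet W (inv C ⁻¹' V)) (h2 : p.1.2 ∈ V) : mul C p ∈ W := by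
  obtain ⟨⟨γ, ρ⟩, h⟩ := p
  obtain ⟨⟨⟨w, v⟩, hwv⟩, ⟨hw, hv⟩, rfl⟩ := h1
  obtain ⟨v, rfl⟩ : ∃ v', v = inv C v' := ⟨_, (inv_inv_arrow v).symm⟩
  have hv' : v ∈ V := by simpa only [mem_preimage, inv_inv_arrow] using hv
  obtain rfl : v = ρ := hV hv' h2 h
  exact mem_of_eq_of_mem (mul_inv_mul w v hwv h) hw

theorem prodSet_inv_self {V : Set (GroupoidArrows C)} (hV : InjOn Quiver.Total.right V) :
    prodSet (inv C ⁻¹' V) V = (fun γ => idArrow γ.left) '' V := by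
  ext δ
  constructor
  · rintro ⟨⟨⟨γ, ρ⟩, h⟩, ⟨hγ, hρ⟩, rfl⟩
    obtain ⟨γ, rfl⟩ : ∃ v', γ = inv C v' := ⟨_, (inv_inv_arrow γ).symm⟩
    have hγ' : γ ∈ V := by simpa only [mem_preimage, inv_inv_arrow] using hγ
    obtain rfl : γ = ρ := hV hγ' hρ h
    exact ⟨γ, hρ, (mul_inv_self_left γ).symm⟩
  · rintro ⟨γ, hγ, rfl⟩
    exact ⟨⟨(inv C γ, γ), rfl⟩, ⟨by simpa only [mem_preimage, inv_inv_arrow] using hγ, hγ⟩,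
      mul_inv_self_left γ⟩

/-- The product `γρ` has the source of `ρ`, which determines `ρ` in `B`; then `γ = (γρ)ρ⁻¹`. -/
theorem injOn_mul {A B : Set (GroupoidArrows C)} (hB : InjOn Quiver.Total.left B) :
    InjOn (mul C) {p | p.1.1 ∈ A ∧ p.1.2 ∈ B} := by
  intro p hp q hq h
  have h2 : p.1.2 = q.1.2 := hB hp.2 hq.2 (congrArg (fun γ : GroupoidArrows C => γ.left) h :)
  have h1 : p.1.1 = q.1.1 := by
    rw [← mul_mul_inv p rfl, ← mul_mul_inv q rfl]
    congr 1
    simp only [h, h2]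
  exact Subtype.ext (Prod.ext h1 h2)

section Borel

variable [MeasurableSpace (GroupoidArrows C)]

theorem measurable_idArrow_left (hC : IsBorelGroupoid C) :
    Measurable fun γ : GroupoidArrows C => idArrow γ.left := by
  have : (fun γ : GroupoidArrows C => idArrow γ.left) =
      fun γ => mul C ⟨(inv C γ, γ), rfl⟩ := funext fun γ => (mul_inv_self_left γ).symm
  rw [this]
  exact hC.measurable_mul.comp ((hC.measurable_inv.prodMk measurable_id).subtype_mk)

theorem measurableSet_composable (hC : IsBorelGroupoid C) : MeasurableSet (composable C) := by
  have := hC.standardBorel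
  have h := measurable_idArrow_left hC
  have e : composable C = {p | idArrow p.1.left = idArrow (inv C p.2).left} := by
    ext p
    exact idArrow_injective.eq_iff.symm
  rw [e]
  exact measurableSet_eq_fun (h.comp measurable_fst)
    (h.comp (hC.measurable_inv.comp measurable_snd))

theorem measurableSet_prodSet (hC : IsBorelGroupoid C) {A B : Set (GroupoidArrows C)}
    (hA : MeasurableSet A) (hB : MeasurableSet B) (hinj : InjOn Quiver.Total.left B) :
    MeasurableSet (prodSet A B) := by
  have := hC.standardBorel
  have := (measurableSet_composable hC).standardBorel
  refine MeasurableSet.image_of_measurable_injOn ?_ hC.measurable_mul (injOn_mul hinj)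
  exact (hA.preimage (measurable_fst.comp measurable_subtype_coe)).inter
    (hB.preimage (measurable_snd.comp measurable_subtype_coe))

/-- A countable Borel groupoid is covered by countably many Borel bisections. -/
theorem exists_bisection_cover (hC : IsCountableBorelGroupoid C) :
    ∃ S : Set (Set (GroupoidArrows C)), S.Countable ∧ (∀ V ∈ S, MeasurableSet V ∧
      InjOn Quiver.Total.left V ∧ InjOn Quiver.Total.right V) ∧ ∀ γ, ∃ V ∈ S, γ ∈ V := by
  have := hC.standardBorel
  obtain ⟨S, hSc, hS, hU⟩ := (measurable_idArrow_left
    hC.toIsBorelGroupoid).exists_injOn_cover_of_countable_fibers (fun y => by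
      by_cases hy : ∃ x : C, idArrow x = y
      · obtain ⟨x, rfl⟩ := hy
        exact (hC.countable_sourceFiber x).mono fun γ hγ => idArrow_injective hγ
      · convert countable_empty
        exact eq_empty_of_forall_notMem fun γ hγ => hy ⟨_, hγ⟩)
  -- The range of `γ` is the source of `γ⁻¹`, so `c` controls sources and `d` controls ranges.
  refine ⟨image2 (fun c d => c ∩ inv C ⁻¹' d) S S, hSc.image2 hSc _, ?_, fun γ => ?_⟩
  · rintro _ ⟨c, hc, d, hd, rfl⟩
    refine ⟨(hS c hc).1.inter (hC.measurable_inv (hS d hd).1), ?_, ?_⟩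
    · intro γ hγ ρ hρ h
      exact (hS c hc).2 hγ.1 hρ.1 (congrArg idArrow h)
    · intro γ hγ ρ hρ h
      have : inv C γ = inv C ρ := (hS d hd).2 hγ.2 hρ.2 (congrArg idArrow h)
      rw [← inv_inv_arrow γ, this, inv_inv_arrow]
  · obtain ⟨c, hc, hγc⟩ := mem_sUnion.1 (hU.symm ▸ mem_univ γ)
    obtain ⟨d, hd, hγd⟩ := mem_sUnion.1 (hU.symm ▸ mem_univ (inv C γ))
    exact ⟨_, ⟨c, hc, d, hd, rfl⟩, hγc, hγd⟩

end Borel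

/-! ### Étale structure from a basis closed under products -/

section Topology

variable [TopologicalSpace (GroupoidArrows C)] {A : Set (Set (GroupoidArrows C))}

/-- For `γρ` in `W` and `ρ` in `V`, the open set `(W V⁻¹) × V` contains `(γ, ρ)`, since `γ =
(γρ)ρ⁻¹`, and multiplication sends its composable pairs into `W`. -/
theorem continuous_mul_of_basis (hA : IsTopologicalBasis A)
    (hcov : ∀ γ, ∃ V ∈ A, γ ∈ V ∧ InjOn Quiver.Total.right V ∧
      ∀ W ∈ A, prodSet W (inv C ⁻¹' V) ∈ A) : Continuous (mul C) := by
  rw [hA.continuous_iff]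
  intro W hW
  rw [isOpen_iff_forall_mem_open]
  intro p hp
  obtain ⟨V, hV, hpV, hinj, hprod⟩ := hcov p.1.2
  refine ⟨Subtype.val ⁻¹' (prodSet W (inv C ⁻¹' V) ×ˢ V),
    fun q hq => mul_mem_of_mem_prodSet_inv hinj hq.1 hq.2,
    ((hA.isOpen (hprod W hW)).prod (hA.isOpen hV)).preimage continuous_subtype_val, ?_, hpV⟩
  exact ⟨⟨(mul C p, inv C p.1.2), rfl⟩,
    ⟨hp, by simpa only [mem_preimage, inv_inv_arrow] using hpV⟩, mul_mul_inv p rfl⟩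

theorem isOpenMap_mul_of_basis (hA : IsTopologicalBasis A)
    (hcov : ∀ γ, ∀ O, IsOpen O → γ ∈ O → ∃ V ∈ A, γ ∈ V ∧ V ⊆ O ∧
      ∀ W ∈ A, prodSet W V ∈ A) : IsOpenMap (mul C) := by
  rintro _ ⟨O, hO, rfl⟩
  rw [isOpen_iff_forall_mem_open]
  rintro _ ⟨p, hp, rfl⟩
  obtain ⟨O₁, O₂, hO₁, hO₂, h1, h2, hsub⟩ := isOpen_prod_iff.1 hO p.1.1 p.1.2 hp
  obtain ⟨W, hW, hpW, hWO⟩ := hA.exists_subset_of_mem_open h1 hO₁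
  obtain ⟨V, hV, hpV, hVO, hprod⟩ := hcov _ O₂ hO₂ h2
  refine ⟨prodSet W V, ?_, hA.isOpen (hprod W hW), ⟨p, ⟨hpW, hpV⟩, rfl⟩⟩
  exact image_mono fun q hq => hsub ⟨hWO hq.1, hVO hq.2⟩

theorem continuous_source (hm : Continuous (mul C)) (hi : Continuous (inv C)) :
    Continuous (source C) := by
  have : Continuous fun γ : GroupoidArrows C => mul C ⟨(inv C γ, γ), rfl⟩ :=
    hm.comp ((hi.prodMk continuous_id).subtype_mk _)
  simp only [mul_inv_self_left] at this
  exact this.subtype_mk _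

/-- For `V` with injective range map, `V⁻¹V` is exactly the set of identities at sources of `V`, so
these form an open set. -/
theorem isOpenMap_source_of_basis (hA : IsTopologicalBasis A)
    (hcov : ∀ γ, ∀ O, IsOpen O → γ ∈ O → ∃ V ∈ A, γ ∈ V ∧ V ⊆ O ∧
      InjOn Quiver.Total.right V ∧ prodSet (inv C ⁻¹' V) V ∈ A) : IsOpenMap (source C) := by
  intro O hO
  rw [isOpen_iff_forall_mem_open]
  rintro _ ⟨γ, hγ, rfl⟩
  obtain ⟨V, hV, hγV, hVO, hinj, hprod⟩ := hcov γ O hO hγ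
  rw [prodSet_inv_self hinj] at hprod
  refine ⟨Subtype.val ⁻¹' ((fun γ => idArrow γ.left) '' V), ?_,
    (hA.isOpen hprod).preimage continuous_subtype_val, ⟨γ, hγV, rfl⟩⟩
  rintro _ ⟨ρ, hρ, h⟩
  exact ⟨ρ, hVO hρ, Subtype.ext h⟩

theorem isLocalHomeomorph_source (hc : Continuous (source C)) (ho : IsOpenMap (source C))
    (hcov : ∀ γ : GroupoidArrows C, ∃ V, IsOpen V ∧ γ ∈ V ∧ InjOn Quiver.Total.left V) :
    IsLocalHomeomorph (source C) := by
  rw [isLocalHomeomorph_iff_isOpenEmbedding_restrict]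
  intro γ
  obtain ⟨V, hV, hγ, hinj⟩ := hcov γ
  refine ⟨V, hV.mem_nhds hγ, .of_continuous_injective_isOpenMap
    (hc.comp continuous_subtype_val) ?_ (ho.comp hV.isOpenMap_subtype_val)⟩
  intro x y h
  exact Subtype.ext (hinj x.2 y.2 (idArrow_injective (congrArg Subtype.val h)))

end Topology

end GroupoidArrows

/-! ### The main theorem -/

open Set GroupoidArrows in
theorem mainTheorem11 (C : Type u) [Groupoid.{v} C] [MeasurableSpace (GroupoidArrows C)]
    (hC : IsCountableBorelGroupoid C) :
    ∃ t : TopologicalSpace (GroupoidArrows C),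
      BorelSpace (GroupoidArrows C) ∧
      IsEtalePolishGroupoid C ∧
      RegularSpace (GroupoidArrows C) ∧
      IsZeroDimensional (GroupoidArrows C) := by
  have := hC.standardBorel
  obtain ⟨S, hSc, hS, hcov⟩ := exists_bisection_cover hC
  obtain ⟨t, A, hpol, hborel, hAc, hIA, hclop, hA, hop⟩ :=
    StandardBorelSpace.exists_polishSpace_clopen_basis_closed (I := insert (objects C) S)
      (hSc.insert _) (by
        rintro s (rfl | hs)
        · exact hC.measurableSet_objects
        · exact (hS s hs).1)
      -- Arbitrary products need not be Borel; closure under products is used only when the right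
      -- factor has injective source map.
      fun (i : Bool) a b => cond i (prodSet a b) (inv C ⁻¹' a)
  have hAm : ∀ s ∈ A, MeasurableSet s := fun s hs => (hclop s hs).2.measurableSet
  have hinv : ∀ a ∈ A, inv C ⁻¹' a ∈ A := fun a ha =>
    hop false a ha a ha (hC.measurable_inv (hAm a ha))
  have hprod : ∀ a ∈ A, ∀ b ∈ A, InjOn Quiver.Total.left b → prodSet a b ∈ A :=
    fun a ha b hb hinj => hop true a ha b hb
      (measurableSet_prodSet hC.toIsBorelGroupoid (hAm a ha) (hAm b hb) hinj)
  have hbis : ∀ γ, ∀ O, IsOpen O → γ ∈ O → ∃ V ∈ A, γ ∈ V ∧ V ⊆ O ∧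
      InjOn Quiver.Total.left V ∧ InjOn Quiver.Total.right V := by
    intro γ O hO hγ
    obtain ⟨V, hV, hγV⟩ := hcov γ
    obtain ⟨W, hW, hγW, hWO⟩ := hA.exists_subset_of_mem_open (⟨hγ, hγV⟩ : γ ∈ O ∩ V)
      (hO.inter (hclop V (hIA (.inr hV))).2)
    have hWV : W ⊆ V := hWO.trans inter_subset_right
    exact ⟨W, hW, hγW, hWO.trans inter_subset_left, (hS V hV).2.1.mono hWV,
      (hS V hV).2.2.mono hWV⟩
  have hinvc : Continuous (inv C) := hA.continuous_iff.2 fun a ha => hA.isOpen (hinv a ha)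
  let e : GroupoidArrows C ≃ₜ GroupoidArrows C :=
    { toFun := inv C, invFun := inv C, left_inv := inv_inv_arrow, right_inv := inv_inv_arrow
      continuous_toFun := hinvc, continuous_invFun := hinvc }
  have hmulc : Continuous (mul C) := continuous_mul_of_basis hA fun γ => by
    obtain ⟨V, hV, hγ, -, -, hr⟩ := hbis γ univ isOpen_univ (mem_univ γ)
    refine ⟨V, hV, hγ, hr, fun W hW => hprod W hW _ (hinv V hV) fun x hx y hy h => ?_⟩
    rw [← inv_inv_arrow x, hr hx hy h, inv_inv_arrow]
  have hsc := continuous_source hmulc hinvc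
  have hso : IsOpenMap (source C) := isOpenMap_source_of_basis hA fun γ O hO hγ => by
    obtain ⟨V, hV, hγ, hVO, hl, hr⟩ := hbis γ O hO hγ
    exact ⟨V, hV, hγ, hVO, hr, hprod _ (hinv V hV) V hV hl⟩
  have hloc : IsLocalHomeomorph (source C) := isLocalHomeomorph_source hsc hso fun γ => by
    obtain ⟨V, hV, hγ, -, hl, -⟩ := hbis γ univ isOpen_univ (mem_univ γ)
    exact ⟨V, hA.isOpen hV, hγ, hl⟩
  have hfib : ∀ x : C, IsClosed (sourceFiber x) := fun x => by
    have : sourceFiber x = source C ⁻¹' {⟨idArrow x, x, rfl⟩} := by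
      ext γ
      exact (Subtype.ext_iff.trans idArrow_injective.eq_iff).symm
    rw [this]
    exact isClosed_singleton.preimage hsc
  -- Range fibers and the range map are obtained from their source counterparts by composing with
  -- inversion.
  refine ⟨t, hborel, ⟨⟨?_, hmulc, ?_, hinvc, e.isOpenMap, ?_, fun x => (hfib x).polishSpace,
    fun x => ((hfib x).preimage hinvc).polishSpace⟩, hloc, hloc.comp e.isLocalHomeomorph⟩,
    inferInstance, ?_⟩
  · exact ⟨A, hAc, hA, fun U hU => (hclop U hU).2.polishSpace⟩
  · refine isOpenMap_mul_of_basis hA fun γ O hO hγ => ?_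
    obtain ⟨V, hV, hγ, hVO, hl, -⟩ := hbis γ O hO hγ
    exact ⟨V, hV, hγ, hVO, fun W hW => hprod W hW V hV hl⟩
  · exact (hclop _ (hIA (.inl rfl))).1.polishSpace
  · exact hA.of_isOpen_of_subset (fun s hs => hs.2) hclop
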